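/- Fix a set of propositional variables; formulas are built from variables with $\bot,\wedge,\vee,\to$, and $\phi\vdash\psi$ denotes intuitionistic entailment. For a set $S$ of variables, let $\mathbf{H}(S)$ be the free Heyting algebra on $S$, i.e. the formulas with variables in $S$ modulo interderivability, ordered by $\vdash$. A formula $\varepsilon$ is a \emph{right uniform interpolant} of $\phi$ with respect to a variable $p$ if (1) every variable of $\varepsilon$ occurs in $\phi$ and is different from $p$, (2) $\phi\vdash\varepsilon$, and (3) $\varepsilon\vdash\theta$ for every formula $\theta$ not containing $p$ with $\phi\vdash\theta$. A formula $\alpha$ is a \emph{left uniform interpolant} of $\phi$ with respect to $p$ if (1) every variable of $\alpha$ occurs in $\phi$ and is different from $p$, (2) $\alpha\vdash\phi$, and (3) $\psi\vdash\alpha$ for every formula $\psi$ not containing $p$ with $\psi\vdash\phi$. An \emph{elementary topos} is a category $\mathcal{E}$ with finite limits in which every object $A$ has a power object $PA$, i.e. an object representing the functor $B\mapsto\mathrm{Sub}_{\mathcal{E}}(A\times B)$, where $\mathrm{Sub}_{\mathcal{E}}(X)$ is the poset of subobjects of $X$ (a Heyting algebra if $\mathcal{E}$ is an elementary topos). Let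 $\Omega:=P1$, where $1$ is the terminal object, and let $!\colon\Omega\to 1$ be the unique morphism. \textbf{Proposition.} Let $\overline{q}$ be an infinite set of variables and $p\notin\overline{q}$ a variable. Let $\mathcal{E}$ be an elementary topos with an isomorphism $\tau\colon\mathrm{Sub}_{\mathcal{E}}(1)\cong\mathbf{H}(\overline{q})$. Then the pullback map $!^{-1}\colon\mathrm{Sub}_{\mathcal{E}}(1)\to\mathrm{Sub}_{\mathcal{E}}(\Omega)$ has a lower adjoint $\exists_!$ and an upper adjoint $\forall_!$, and there is an injective homomorphism of Heyting algebras $j\colon\mathbf{H}(\{p\}\cup\overline{q})\to\mathrm{Sub}_{\mathcal{E}}(\Omega)$ such that, for every formula $\phi$ with variables in $\{p\}\cup\overline{q}$, the elements $\tau(\exists_!(j(\phi)))$ and $\tau(\forall_!(j(\phi)))$ of $\mathbf{H}(\overline{q})$ are the classes of a right and of a left uniform interpolant of $\phi$ with respect to $p$, respectively. -/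

import Mathlib

open CategoryTheory CategoryTheory.Limits

/-! ### Intuitionistic propositional logic -/

namespace IPC

universe w

/-- Propositional formulas with variables in `V`. Truth is the formula `⊥ → ⊥`. -/
inductive Formula (V : Type w) : Type w
  | var : V → Formula V
  | bot : Formula V
  | and : Formula V → Formula V → Formula V
  | or : Formula V → Formula V → Formula V
  | imp : Formula V → Formula V → Formula V

namespace Formula

/-- The set of variables that occur in a formula. -/
def vars {V : Type w} : Formula V → Set V
  | var x => {x}
  | bot => ∅
  | and φ ψ => φ.vars ∪ ψ.vars
  | or φ ψ => φ.vars ∪ ψ.vars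
  | imp φ ψ => φ.vars ∪ ψ.vars

end Formula

/-- Natural deduction for intuitionistic propositional logic: `Derivable Γ φ` says that `φ` is
derivable from the assumptions `Γ`. -/
inductive Derivable {V : Type w} : Set (Formula V) → Formula V → Prop
  | ax {Γ : Set (Formula V)} {φ : Formula V} : φ ∈ Γ → Derivable Γ φ
  | botE {Γ : Set (Formula V)} {φ : Formula V} : Derivable Γ Formula.bot → Derivable Γ φ
  | andI {Γ : Set (Formula V)} {φ ψ : Formula V} :
      Derivable Γ φ → Derivable Γ ψ → Derivable Γ (Formula.and φ ψ)
  | andE₁ {Γ : Set (Formula V)} {φ ψ : Formula V} : Derivable Γ (Formula.and φ ψ) → Derivable Γ φ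
  | andE₂ {Γ : Set (Formula V)} {φ ψ : Formula V} : Derivable Γ (Formula.and φ ψ) → Derivable Γ ψ
  | orI₁ {Γ : Set (Formula V)} {φ ψ : Formula V} : Derivable Γ φ → Derivable Γ (Formula.or φ ψ)
  | orI₂ {Γ : Set (Formula V)} {φ ψ : Formula V} : Derivable Γ ψ → Derivable Γ (Formula.or φ ψ)
  | orE {Γ : Set (Formula V)} {φ ψ χ : Formula V} : Derivable Γ (Formula.or φ ψ) →
      Derivable (insert φ Γ) χ → Derivable (insert ψ Γ) χ → Derivable Γ χ
  | impI {Γ : Set (Formula V)} {φ ψ : Formula V} :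
      Derivable (insert φ Γ) ψ → Derivable Γ (Formula.imp φ ψ)
  | impE {Γ : Set (Formula V)} {φ ψ : Formula V} :
      Derivable Γ (Formula.imp φ ψ) → Derivable Γ φ → Derivable Γ ψ

theorem Derivable.weaken {V : Type w} {Γ : Set (Formula V)} {φ : Formula V} (h : Derivable Γ φ) :
    ∀ {Δ : Set (Formula V)}, Γ ⊆ Δ → Derivable Δ φ := by
  induction h with
  | ax h => intro Δ hs; exact .ax (hs h)
  | botE _ ih => intro Δ hs; exact .botE (ih hs)
  | andI _ _ ih₁ ih₂ => intro Δ hs; exact .andI (ih₁ hs) (ih₂ hs)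
  | andE₁ _ ih => intro Δ hs; exact .andE₁ (ih hs)
  | andE₂ _ ih => intro Δ hs; exact .andE₂ (ih hs)
  | orI₁ _ ih => intro Δ hs; exact .orI₁ (ih hs)
  | orI₂ _ ih => intro Δ hs; exact .orI₂ (ih hs)
  | orE _ _ _ ih ih₁ ih₂ =>
    intro Δ hs
    exact .orE (ih hs) (ih₁ (Set.insert_subset_insert hs)) (ih₂ (Set.insert_subset_insert hs))
  | impI _ ih => intro Δ hs; exact .impI (ih (Set.insert_subset_insert hs))
  | impE _ _ ih₁ ih₂ => intro Δ hs; exact .impE (ih₁ hs) (ih₂ hs)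

/-- Intuitionistic entailment `φ ⊢ ψ`. -/
def Entails {V : Type w} (φ ψ : Formula V) : Prop := Derivable {φ} ψ

theorem Entails.cut {V : Type w} {Γ : Set (Formula V)} {φ ψ : Formula V} (h : Entails φ ψ)
    (hφ : Derivable Γ φ) : Derivable Γ ψ :=
  .impE (.impI (h.weaken (by simp))) hφ

/-- `ε` is a right uniform interpolant of `φ` with respect to the variable `p`. -/
structure IsRightUniformInterpolant {V : Type w} (p : V) (φ ε : Formula V) : Prop where
  vars_subset : ε.vars ⊆ φ.vars \ {p}
  entails : Entails φ ε
  least : ∀ θ : Formula V, p ∉ θ.vars → Entails φ θ → Entails ε θ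

/-- `α` is a left uniform interpolant of `φ` with respect to the variable `p`. -/
structure IsLeftUniformInterpolant {V : Type w} (p : V) (φ α : Formula V) : Prop where
  vars_subset : α.vars ⊆ φ.vars \ {p}
  entails : Entails α φ
  greatest : ∀ ψ : Formula V, p ∉ ψ.vars → Entails ψ φ → Entails ψ α

/-- Formulas all of whose variables belong to `S`, preordered by entailment. -/
def FormulaIn {V : Type w} (S : Set V) : Type w := {φ : Formula V // φ.vars ⊆ S}

instance {V : Type w} (S : Set V) : Preorder (FormulaIn S) where
  le φ ψ := Entails φ.1 ψ.1
  le_refl _ := .ax rfl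
  le_trans _ _ _ h₁ h₂ := h₂.cut h₁

/-- The free Heyting algebra `H(S)` on a set `S` of variables: formulas in these variables modulo
interderivability, ordered by entailment. -/
def FreeHeyting {V : Type w} (S : Set V) : Type w := Antisymmetrization (FormulaIn S) (· ≤ ·)

instance {V : Type w} (S : Set V) : PartialOrder (FreeHeyting S) :=
  inferInstanceAs (PartialOrder (Antisymmetrization (FormulaIn S) (· ≤ ·)))

/-- The equivalence class in `H(S)` of a formula `φ` with variables in `S`. -/
def FreeHeyting.mk {V : Type w} {S : Set V} (φ : Formula V) (h : φ.vars ⊆ S) : FreeHeyting S :=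
  toAntisymmetrization (· ≤ ·) (⟨φ, h⟩ : FormulaIn S)

namespace FreeHeyting

theorem mk_le_mk {V : Type w} {S : Set V} {φ ψ : Formula V} (hφ : φ.vars ⊆ S)
    (hψ : ψ.vars ⊆ S) : mk φ hφ ≤ mk ψ hψ ↔ Entails φ ψ :=
  Iff.rfl

theorem ind {V : Type w} {S : Set V} {P : FreeHeyting S → Prop}
    (h : ∀ (φ : Formula V) (hφ : φ.vars ⊆ S), P (mk φ hφ)) (a : FreeHeyting S) : P a :=
  Quotient.inductionOn a fun φ => h φ.1 φ.2

/-- The operation on `H(S)` induced by a binary connective. -/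
def lift₂ {V : Type w} {S : Set V} (c : Formula V → Formula V → Formula V)
    (hv : ∀ φ ψ, (c φ ψ).vars = φ.vars ∪ ψ.vars)
    (hc : ∀ φ φ' ψ ψ', Entails φ φ' → Entails φ' φ → Entails ψ ψ' → Entails ψ' ψ →
      Entails (c φ ψ) (c φ' ψ')) : FreeHeyting S → FreeHeyting S → FreeHeyting S :=
  Quotient.map₂ (fun φ ψ => ⟨c φ.1 ψ.1, (hv _ _).trans_subset (Set.union_subset φ.2 ψ.2)⟩)
    fun _ _ h _ _ k => ⟨hc _ _ _ _ h.1 h.2 k.1 k.2, hc _ _ _ _ h.2 h.1 k.2 k.1⟩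

/-- The conjunction of `H(S)`. -/
def conj {V : Type w} {S : Set V} : FreeHeyting S → FreeHeyting S → FreeHeyting S :=
  lift₂ Formula.and (fun _ _ => rfl) fun _ _ _ _ h _ k _ =>
    .andI (h.cut (.andE₁ (.ax rfl))) (k.cut (.andE₂ (.ax rfl)))

/-- The disjunction of `H(S)`. -/
def disj {V : Type w} {S : Set V} : FreeHeyting S → FreeHeyting S → FreeHeyting S :=
  lift₂ Formula.or (fun _ _ => rfl) fun _ _ _ _ h _ k _ =>
    .orE (.ax rfl) (.orI₁ (h.cut (.ax (by simp)))) (.orI₂ (k.cut (.ax (by simp))))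

/-- The implication of `H(S)`. -/
def impl {V : Type w} {S : Set V} : FreeHeyting S → FreeHeyting S → FreeHeyting S :=
  lift₂ Formula.imp (fun _ _ => rfl) fun φ _ ψ _ _ h k _ =>
    .impI (k.cut (.impE (φ := φ) (.ax (by simp)) (h.cut (.ax (by simp)))))

instance {V : Type w} (S : Set V) : HeytingAlgebra (FreeHeyting S) where
  __ := (inferInstance : PartialOrder (FreeHeyting S))
  inf := conj
  sup := disj
  himp := impl
  top := mk (.imp .bot .bot) (by simp [Formula.vars])
  bot := mk .bot (by simp [Formula.vars])
  compl a := impl a (mk .bot (by simp [Formula.vars]))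
  inf_le_left := ind fun _ _ => ind fun _ _ => Derivable.andE₁ (.ax rfl)
  inf_le_right := ind fun _ _ => ind fun _ _ => Derivable.andE₂ (.ax rfl)
  le_inf := ind fun _ _ => ind fun _ _ => ind fun _ _ h k => Derivable.andI h k
  le_sup_left := ind fun _ _ => ind fun _ _ => Derivable.orI₁ (.ax rfl)
  le_sup_right := ind fun _ _ => ind fun _ _ => Derivable.orI₂ (.ax rfl)
  sup_le := ind fun _ _ => ind fun _ _ => ind fun _ _ h k =>
    Derivable.orE (.ax rfl) (Entails.cut h (.ax (by simp))) (Entails.cut k (.ax (by simp)))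
  le_top := ind fun _ _ => Derivable.impI (.ax (by simp))
  bot_le := ind fun _ _ => Derivable.botE (.ax rfl)
  le_himp_iff := ind fun φ _ => ind fun ψ _ => ind fun χ _ =>
    ⟨fun h => Derivable.impE (Entails.cut h (.andE₁ (.ax rfl))) (.andE₂ (.ax rfl)),
      fun h => Derivable.impI (Entails.cut h (.andI (.ax (by simp)) (.ax (by simp))))⟩
  himp_bot _ := rfl

end FreeHeyting

end IPC

/-! ### Elementary toposes -/

section

universe v u

/-- The contravariant functor `B ↦ Sub(A × B)`; it acts on morphisms by pulling back. -/
noncomputable def powerPresheaf (C : Type u) [Category.{v} C] [HasFiniteLimits C] (A : C) :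
    Cᵒᵖ ⥤ Type (max u v) :=
  (prod.functor.obj A).op ⋙ Subobject.presheaf C

/-- An elementary topos is a category with finite limits in which every object `A` has a power
object, that is, an object representing `B ↦ Sub(A × B)`. -/
class ElementaryTopos (C : Type u) [Category.{v} C] : Prop extends HasFiniteLimits C where
  power_isRepresentable : ∀ A : C, (powerPresheaf C A).IsRepresentable

namespace ElementaryTopos

/-- The power object `PA`. -/
noncomputable def powerObj {C : Type u} [Category.{v} C] [ElementaryTopos C] (A : C) : C :=
  haveI := power_isRepresentable A
  (powerPresheaf C A).reprX

/-- The object `Ω = P1`, a subobject classifier. -/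
noncomputable def omega (C : Type u) [Category.{v} C] [ElementaryTopos C] : C :=
  powerObj (⊤_ C)

/-- Inverse image `!⁻¹ : Sub(1) → Sub(A)` along the unique morphism `! : A ⟶ 1`. -/
noncomputable def bangInv {C : Type u} [Category.{v} C] [ElementaryTopos C] (A : C) :
    Subobject (⊤_ C) → Subobject A :=
  (Subobject.pullback (terminal.from A)).obj

end ElementaryTopos

end

/-! ### Embeddings of Heyting algebras -/

/-- The ordered set `P` is a Heyting algebra (the operations are then determined by the order of
`P`), and `j : A → P` is an injective homomorphism of Heyting algebras. -/
def IsHeytingEmbedding {A : Type*} {P : Type*} [HeytingAlgebra A] [o : PartialOrder P]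
    (j : A → P) : Prop :=
  ∃ hP : HeytingAlgebra P, (∀ x y : P, hP.le x y ↔ o.le x y) ∧
    ∃ f : @HeytingHom A P _ hP, f.toFun = j ∧ Function.Injective j

/-! ### Substitution and interpretation in Heyting algebras -/

namespace IPC

universe w

namespace Formula

variable {V : Type w}

/-! Interpret `p` as the generic subobject of Ω and each variable q of `Q` as the inverse image of
the subterminal object `τ.symm` [q]. This extends to a Heyting homomorphism j on H({p} ∪ Q), which
on formulas over `Q` is inverse image along Ω ⟶ 1 after `τ.symm`.

It reflects entailment (`entails_of_eval_genericValuation_le`). Given φ and ψ, choose q in `Q`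
occurring in neither and let U be the subterminal object of q. Inverse image along the point 1 ⟶ Ω
classifying U sends the generic subobject to U and undoes inverse image along Ω ⟶ 1. Followed by
`τ`, it therefore sends the interpretation of χ to the class of χ[q/p]. An inequality in Sub(Ω) thus
yields φ[q/p] ⊢ ψ[q/p], and substituting `p` for q gives φ ⊢ ψ.

The adjoints are the internal quantifiers over Ω. For θ over `Q`, adjunction gives τ(∃ jφ) ≤ [θ] iff
jφ ≤ jθ iff φ ⊢ θ, and dually for ∀. So these elements are extremal among formulas over `Q`.
`exists_uniform_of_extremal` then confines the variables to those of φ and extends extremality to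
all formulas without `p`. -/

theorem vars_finite : ∀ φ : Formula V, φ.vars.Finite
  | var x => Set.finite_singleton x
  | bot => Set.finite_empty
  | and φ ψ => φ.vars_finite.union ψ.vars_finite
  | or φ ψ => φ.vars_finite.union ψ.vars_finite
  | imp φ ψ => φ.vars_finite.union ψ.vars_finite

/-- Simultaneous substitution of formulas for variables. -/
def subst (σ : V → Formula V) : Formula V → Formula V
  | var x => σ x
  | bot => bot
  | and φ ψ => and (φ.subst σ) (ψ.subst σ)
  | or φ ψ => or (φ.subst σ) (ψ.subst σ)
  | imp φ ψ => imp (φ.subst σ) (ψ.subst σ)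

theorem subst_congr {σ τ : V → Formula V} :
    ∀ {φ : Formula V}, (∀ x ∈ φ.vars, σ x = τ x) → φ.subst σ = φ.subst τ
  | var x, h => h x rfl
  | bot, _ => rfl
  | and _ _, h | or _ _, h | imp _ _, h => by
    simp only [subst]
    rw [subst_congr fun x hx => h x (Or.inl hx), subst_congr fun x hx => h x (Or.inr hx)]

theorem subst_var : ∀ φ : Formula V, φ.subst var = φ
  | var _ => rfl
  | bot => rfl
  | and φ ψ | or φ ψ | imp φ ψ => by simp only [subst, φ.subst_var, ψ.subst_var]

theorem subst_eq_self {σ : V → Formula V} {φ : Formula V} (h : ∀ x ∈ φ.vars, σ x = var x) :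
    φ.subst σ = φ :=
  (subst_congr h).trans φ.subst_var

theorem subst_subst (σ τ : V → Formula V) :
    ∀ φ : Formula V, (φ.subst σ).subst τ = φ.subst fun x => (σ x).subst τ
  | var _ => rfl
  | bot => rfl
  | and φ ψ | or φ ψ | imp φ ψ => by simp only [subst, φ.subst_subst, ψ.subst_subst]

theorem vars_subst_subset {σ : V → Formula V} {S : Set V} :
    ∀ {φ : Formula V}, (∀ x ∈ φ.vars, (σ x).vars ⊆ S) → (φ.subst σ).vars ⊆ S
  | var x, h => h x rfl
  | bot, _ => Set.empty_subset _
  | and _ _, h | or _ _, h | imp _ _, h =>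
    Set.union_subset (vars_subst_subset fun x hx => h x (Or.inl hx))
      (vars_subst_subset fun x hx => h x (Or.inr hx))

/-- The value of a formula in a Heyting algebra under a valuation of the variables. -/
def eval {H : Type*} [HeytingAlgebra H] (v : V → H) : Formula V → H
  | var x => v x
  | bot => ⊥
  | and φ ψ => φ.eval v ⊓ ψ.eval v
  | or φ ψ => φ.eval v ⊔ ψ.eval v
  | imp φ ψ => φ.eval v ⇨ ψ.eval v

theorem eval_congr {H : Type*} [HeytingAlgebra H] {v v' : V → H} :
    ∀ {φ : Formula V}, (∀ x ∈ φ.vars, v x = v' x) → φ.eval v = φ.eval v'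
  | var x, h => h x rfl
  | bot, _ => rfl
  | and _ _, h | or _ _, h | imp _ _, h => by
    simp only [eval]
    rw [eval_congr fun x hx => h x (Or.inl hx), eval_congr fun x hx => h x (Or.inr hx)]

theorem map_eval {H K F : Type*} [HeytingAlgebra H] [HeytingAlgebra K] [FunLike F H K]
    [HeytingHomClass F H K] (f : F) (v : V → H) :
    ∀ φ : Formula V, f (φ.eval v) = φ.eval fun x => f (v x)
  | var _ => rfl
  | bot => map_bot f
  | and φ ψ => by simp only [eval, map_inf, φ.map_eval, ψ.map_eval]
  | or φ ψ => by simp only [eval, map_sup, φ.map_eval, ψ.map_eval]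
  | imp φ ψ => by simp only [eval, map_himp, φ.map_eval, ψ.map_eval]

end Formula

variable {V : Type w}

theorem Derivable.subst {Γ : Set (Formula V)} {φ : Formula V} (h : Derivable Γ φ)
    (σ : V → Formula V) : Derivable (Formula.subst σ '' Γ) (φ.subst σ) := by
  induction h with
  | ax h => exact .ax ⟨_, h, rfl⟩
  | botE _ ih => exact .botE ih
  | andI _ _ ih₁ ih₂ => exact .andI ih₁ ih₂
  | andE₁ _ ih => exact .andE₁ ih
  | andE₂ _ ih => exact .andE₂ ih
  | orI₁ _ ih => exact .orI₁ ih
  | orI₂ _ ih => exact .orI₂ ih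
  | orE _ _ _ ih ih₁ ih₂ =>
    rw [Set.image_insert_eq] at ih₁ ih₂
    exact .orE ih ih₁ ih₂
  | impI _ ih =>
    rw [Set.image_insert_eq] at ih
    exact .impI ih
  | impE _ _ ih₁ ih₂ => exact .impE ih₁ ih₂

theorem Entails.subst {φ ψ : Formula V} (h : Entails φ ψ) (σ : V → Formula V) :
    Entails (φ.subst σ) (ψ.subst σ) := by
  have := Derivable.subst h σ
  rwa [Set.image_singleton] at this

/-- Soundness. Since `Γ` may be infinite and `H` need not be complete, a lower bound `a` of the
assumptions replaces their meet; discharging an assumption meets `a` with its value. -/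
theorem Derivable.le_eval {H : Type*} [HeytingAlgebra H] (v : V → H) {Γ : Set (Formula V)}
    {φ : Formula V} (h : Derivable Γ φ) : ∀ a : H, (∀ γ ∈ Γ, a ≤ γ.eval v) → a ≤ φ.eval v := by
  have key : ∀ {Γ : Set (Formula V)} {a : H} {φ : Formula V}, (∀ γ ∈ Γ, a ≤ γ.eval v) →
      ∀ γ ∈ insert φ Γ, a ⊓ φ.eval v ≤ γ.eval v := by
    rintro Γ a φ ha γ (rfl | hγ)
    · exact inf_le_right
    · exact inf_le_left.trans (ha γ hγ)
  induction h with
  | ax h => exact fun a ha => ha _ h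
  | botE _ ih => exact fun a ha => (ih a ha).trans bot_le
  | andI _ _ ih₁ ih₂ => exact fun a ha => le_inf (ih₁ a ha) (ih₂ a ha)
  | andE₁ _ ih => exact fun a ha => (ih a ha).trans inf_le_left
  | andE₂ _ ih => exact fun a ha => (ih a ha).trans inf_le_right
  | orI₁ _ ih => exact fun a ha => (ih a ha).trans le_sup_left
  | orI₂ _ ih => exact fun a ha => (ih a ha).trans le_sup_right
  | orE _ _ _ ih ih₁ ih₂ =>
    intro a ha
    refine (le_inf le_rfl (ih a ha)).trans ?_
    rw [Formula.eval, inf_sup_left]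
    exact sup_le (ih₁ _ (key ha)) (ih₂ _ (key ha))
  | impI _ ih => exact fun a ha => le_himp_iff.2 (ih _ (key ha))
  | impE _ _ ih₁ ih₂ =>
    exact fun a ha => (le_inf (ih₁ a ha) (ih₂ a ha)).trans himp_inf_le

theorem Entails.eval_le_eval {H : Type*} [HeytingAlgebra H] (v : V → H) {φ ψ : Formula V}
    (h : Entails φ ψ) : φ.eval v ≤ ψ.eval v :=
  Derivable.le_eval v h _ fun _ hγ => hγ ▸ le_rfl

namespace FreeHeyting

variable {S : Set V} {H : Type*} [HeytingAlgebra H]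

theorem mk_eq_mk {φ ψ : Formula V} (hφ : φ.vars ⊆ S) (hψ : ψ.vars ⊆ S) :
    mk φ hφ = mk ψ hψ ↔ Entails φ ψ ∧ Entails ψ φ := by
  rw [le_antisymm_iff, mk_le_mk, mk_le_mk]

/-- The homomorphism of Heyting algebras out of `H(S)` that extends a valuation. -/
def lift (v : V → H) : HeytingHom (FreeHeyting S) H where
  toFun := Quotient.lift (fun φ : FormulaIn S => φ.1.eval v) fun _ _ h =>
    le_antisymm (h.1.eval_le_eval v) (h.2.eval_le_eval v)
  map_sup' := ind fun _ _ => ind fun _ _ => rfl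
  map_inf' := ind fun _ _ => ind fun _ _ => rfl
  map_bot' := rfl
  map_himp' := ind fun _ _ => ind fun _ _ => rfl

theorem lift_mk (v : V → H) {φ : Formula V} (h : φ.vars ⊆ S) : lift v (mk φ h) = φ.eval v :=
  rfl

/-- A valuation in `H(S)` by classes of formulas acts on formulas as a substitution. -/
theorem eval_eq_mk_subst {v : V → FreeHeyting S} {σ : V → Formula V} :
    ∀ {φ : Formula V} (_ : ∀ x ∈ φ.vars, ∃ h : (σ x).vars ⊆ S, v x = mk (σ x) h)
      (h : (φ.subst σ).vars ⊆ S), φ.eval v = mk (φ.subst σ) h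
  | .var x, hv, _ => (hv x rfl).2
  | .bot, _, _ => rfl
  | .and φ ψ, hv, h => by
    rw [Formula.eval, eval_eq_mk_subst (fun x hx => hv x (Or.inl hx)) (Set.union_subset_iff.1 h).1,
      eval_eq_mk_subst (fun x hx => hv x (Or.inr hx)) (Set.union_subset_iff.1 h).2]
    rfl
  | .or φ ψ, hv, h => by
    rw [Formula.eval, eval_eq_mk_subst (fun x hx => hv x (Or.inl hx)) (Set.union_subset_iff.1 h).1,
      eval_eq_mk_subst (fun x hx => hv x (Or.inr hx)) (Set.union_subset_iff.1 h).2]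
    rfl
  | .imp φ ψ, hv, h => by
    rw [Formula.eval, eval_eq_mk_subst (fun x hx => hv x (Or.inl hx)) (Set.union_subset_iff.1 h).1,
      eval_eq_mk_subst (fun x hx => hv x (Or.inr hx)) (Set.union_subset_iff.1 h).2]
    rfl

end FreeHeyting

/-! ### Interpolants over an infinite set of variables -/

theorem exists_fresh_renaming {Q F : Set V} (hQ : Q.Infinite) (hF : F.Finite) (θ : Formula V) :
    ∃ e : V → V, Set.InjOn e θ.vars ∧ ∀ x, e x ∈ Q \ F := by
  obtain ⟨n, hn⟩ := Set.countable_iff_exists_injOn.1 θ.vars_finite.countable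
  let g := (hQ.sdiff hF).natEmbedding
  exact ⟨fun x => g (n x), fun x hx y hy h => hn hx hy (g.injective (Subtype.ext h)),
    fun x => (g (n x)).2⟩

/-- Let `R` be entailment or its converse. A formula over `Q` that is extremal among the formulas
over `Q` related to `φ` is so among all formulas without `p`, and up to interderivability its
variables occur in `φ`. -/
theorem exists_uniform_of_extremal {p : V} {Q : Set V} (hQ : Q.Infinite) (hp : p ∉ Q)
    {R : Formula V → Formula V → Prop}
    (hR : ∀ {a b : Formula V} (σ : V → Formula V), R a b → R (a.subst σ) (b.subst σ))
    {φ ε₀ : Formula V} (hφ : φ.vars ⊆ insert p Q) (hε₀ : ε₀.vars ⊆ Q) (h : R φ ε₀)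
    (hext : ∀ θ : Formula V, θ.vars ⊆ Q → R φ θ → R ε₀ θ) :
    ∃ ε : Formula V, ε.vars ⊆ φ.vars \ {p} ∧ R ε₀ ε ∧ R φ ε ∧
      ∀ θ : Formula V, p ∉ θ.vars → R φ θ → R ε θ := by
  classical
  -- Any formula would do for the variables foreign to `φ`: the substitution fixes `φ`, so it
  -- preserves being related to it.
  let σ : V → Formula V := fun x => if x ∈ φ.vars then .var x else .bot
  have hε : (ε₀.subst σ).vars ⊆ φ.vars \ {p} := by
    refine Formula.vars_subst_subset fun x hx => ?_
    by_cases hxφ : x ∈ φ.vars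
    · simp only [σ, if_pos hxφ, Formula.vars, Set.singleton_subset_iff]
      exact ⟨hxφ, fun hxp => hp (hxp ▸ hε₀ hx)⟩
    · simp [σ, if_neg hxφ, Formula.vars]
  have hφε : R φ (ε₀.subst σ) := by
    have := hR σ h
    rwa [Formula.subst_eq_self fun x hx => if_pos hx] at this
  refine ⟨ε₀.subst σ, hε, hext _ (fun x hx => ?_) hφε, hφε, fun θ hθ hφθ => ?_⟩
  · exact (hφ (hε hx).1).resolve_left (hε hx).2
  obtain ⟨e, he, heQ⟩ := exists_fresh_renaming hQ (φ.vars_finite.union ε₀.vars_finite) θ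
  -- `θ` may have variables outside `Q`, where extremality of `ε₀` says nothing. So `ρ` moves those
  -- not in `φ` to fresh ones in `Q`, and `κ` moves them back. The default ⊥ of `κ` makes it agree
  -- with `σ` on `ε₀`, whose variables the renaming avoids.
  let ρ : V → Formula V := fun x => if x ∈ φ.vars then .var x else .var (e x)
  let κ : V → Formula V := fun x => if x ∈ φ.vars then .var x else
    if hx : ∃ y ∈ θ.vars, e y = x then .var hx.choose else .bot
  have hρ : R φ (θ.subst ρ) := by
    have := hR ρ hφθ
    rwa [Formula.subst_eq_self fun x hx => if_pos hx] at this
  have hρQ : (θ.subst ρ).vars ⊆ Q := by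
    refine Formula.vars_subst_subset fun x hx => ?_
    by_cases hxφ : x ∈ φ.vars
    · simp only [ρ, if_pos hxφ, Formula.vars, Set.singleton_subset_iff]
      exact (hφ hxφ).resolve_left fun hxp => hθ (hxp ▸ hx)
    · simp only [ρ, if_neg hxφ, Formula.vars, Set.singleton_subset_iff]
      exact (heQ x).1
  have hκ := hR κ (hext _ hρQ hρ)
  have h₁ : ε₀.subst κ = ε₀.subst σ := by
    refine Formula.subst_congr fun x hx => ?_
    have : ¬∃ y ∈ θ.vars, e y = x := by
      rintro ⟨y, -, rfl⟩
      exact (heQ y).2 (Or.inr hx)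
    simp only [κ, σ, dif_neg this]
  have h₂ : (θ.subst ρ).subst κ = θ := by
    rw [Formula.subst_subst]
    refine Formula.subst_eq_self fun x hx => ?_
    by_cases hxφ : x ∈ φ.vars
    · simp only [ρ, κ, if_pos hxφ, Formula.subst]
    · have hex : e x ∉ φ.vars := fun h => (heQ x).2 (Or.inl h)
      have hx' : ∃ y ∈ θ.vars, e y = e x := ⟨x, hx, rfl⟩
      simp only [ρ, κ, if_neg hxφ, Formula.subst, if_neg hex, dif_pos hx']
      rw [he hx'.choose_spec.1 hx hx'.choose_spec.2]
  rwa [h₁, h₂] at hκ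

end IPC

/-! ### The Heyting algebras of subobjects in an elementary topos -/

namespace ElementaryTopos

universe v u

/-- A subobject is determined by the generalized elements satisfying it. The logic of subobjects
below is computed in this way, by Kripke–Joyal forcing clauses. -/
theorem le_iff_factors {C : Type u} [Category.{v} C] {X : C} {S T : Subobject X} :
    S ≤ T ↔ ∀ ⦃Y : C⦄ (f : Y ⟶ X), S.Factors f → T.Factors f :=
  ⟨fun h _ f => Subobject.factors_of_le f h,
    fun h => Subobject.le_of_factors (h _ S.factors_self)⟩

theorem eq_iff_factors {C : Type u} [Category.{v} C] {X : C} {S T : Subobject X} :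
    S = T ↔ ∀ ⦃Y : C⦄ (f : Y ⟶ X), S.Factors f ↔ T.Factors f :=
  ⟨fun h _ _ => h ▸ Iff.rfl, fun h =>
    le_antisymm (le_iff_factors.2 fun _ f => (h f).1) (le_iff_factors.2 fun _ f => (h f).2)⟩

variable {C : Type u} [Category.{v} C] [ElementaryTopos C]

/-- The bijection between morphisms `B ⟶ PA` and subobjects of `A ⨯ B`. -/
noncomputable def powerEquiv (A B : C) : (B ⟶ powerObj A) ≃ Subobject (A ⨯ B) :=
  haveI := power_isRepresentable A
  (powerPresheaf C A).representableBy.homEquiv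

theorem powerEquiv_comp {A B B' : C} (f : B ⟶ B') (g : B' ⟶ powerObj A) :
    powerEquiv A B (f ≫ g) =
      (Subobject.pullback (prod.map (𝟙 A) f)).obj (powerEquiv A B' g) :=
  haveI := power_isRepresentable A
  (powerPresheaf C A).representableBy.homEquiv_comp f g

/-- Yoneda: the relation named by `g` is the pullback of the universal membership relation along 𝟙 ×
`g`. -/
theorem powerEquiv_factors {A B Y : C} (g : B ⟶ powerObj A) (a : Y ⟶ A) (b : Y ⟶ B) :
    (powerEquiv A B g).Factors (prod.lift a b) ↔
      (powerEquiv A (powerObj A) (𝟙 _)).Factors (prod.lift a (b ≫ g)) := by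
  rw [← Category.comp_id g, powerEquiv_comp, Limits.pullback_factors_iff, prod.lift_map,
    Category.comp_id, Category.comp_id]

/-- The generic subobject of `Ω`. -/
noncomputable def truth (C : Type u) [Category.{v} C] [ElementaryTopos C] :
    Subobject (omega C) :=
  (Subobject.pullback (prod.lift (terminal.from _) (𝟙 _))).obj (powerEquiv (⊤_ C) (omega C) (𝟙 _))

/-- The characteristic morphism of a subobject. -/
noncomputable def char {X : C} (S : Subobject X) : X ⟶ omega C :=
  (powerEquiv (⊤_ C) X).symm ((Subobject.pullback prod.snd).obj S)

theorem truth_factors_comp {X Y : C} (f : Y ⟶ X) (g : X ⟶ omega C) :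
    (truth C).Factors (f ≫ g) ↔
      (powerEquiv (⊤_ C) X g).Factors (prod.lift (terminal.from Y) f) := by
  rw [truth, Limits.pullback_factors_iff, prod.comp_lift, Category.comp_id, terminal.comp_from]
  exact (powerEquiv_factors g (terminal.from Y) f).symm

theorem truth_factors_char {X Y : C} (S : Subobject X) (f : Y ⟶ X) :
    (truth C).Factors (f ≫ char S) ↔ S.Factors f := by
  rw [truth_factors_comp, char]
  erw [Equiv.apply_symm_apply]
  rw [Limits.pullback_factors_iff, prod.lift_snd]

theorem omega_hom_ext {X : C} {g h : X ⟶ omega C}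
    (H : ∀ ⦃Y : C⦄ (f : Y ⟶ X), (truth C).Factors (f ≫ g) ↔ (truth C).Factors (f ≫ h)) :
    g = h := by
  refine (powerEquiv (⊤_ C) X).injective (eq_iff_factors.2 fun Y f => ?_)
  have hf : f = prod.lift (terminal.from Y) (f ≫ prod.snd) := by
    apply Limits.prod.hom_ext
    · exact Subsingleton.elim _ _
    · rw [prod.lift_snd]
  rw [hf, ← truth_factors_comp, ← truth_factors_comp]
  exact H _

/-- Implication of subobjects. -/
noncomputable def imp {X : C} (S T : Subobject X) : Subobject X :=
  equalizerSubobject (char S) (char (S ⊓ T))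

/-- The equalizer is the locus where S and S ∧ T have the same truth value, and truth values agree
as soon as they hold at the same later stages. -/
theorem imp_factors {X Y : C} (S T : Subobject X) (f : Y ⟶ X) :
    (imp S T).Factors f ↔ ∀ ⦃Z : C⦄ (g : Z ⟶ Y), S.Factors (g ≫ f) → T.Factors (g ≫ f) := by
  rw [imp, equalizerSubobject_factors_iff]
  constructor
  · intro h Z g hS
    have := (truth_factors_char S (g ≫ f)).2 hS
    rw [Category.assoc, h, ← Category.assoc, truth_factors_char, Subobject.inf_factors] at this
    exact this.2
  · intro h
    refine omega_hom_ext fun Z g => ?_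
    rw [← Category.assoc, ← Category.assoc, truth_factors_char, truth_factors_char,
      Subobject.inf_factors]
    exact ⟨fun hS => ⟨hS, h g hS⟩, And.left⟩

/-- Universal quantification along the projection `A ⨯ X ⟶ X`. -/
noncomputable def all {A X : C} (S : Subobject (A ⨯ X)) : Subobject X :=
  equalizerSubobject ((powerEquiv A X).symm S) ((powerEquiv A X).symm ⊤)

/-- The equalizer of the names of `S` and ⊤ is the locus where the fibre of `S` is all of `A`. Both
names pull back to subobjects of `A ⨯ Y`, whose generalized elements are pairs. -/
theorem all_factors {A X Y : C} (S : Subobject (A ⨯ X)) (f : Y ⟶ X) :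
    (all S).Factors f ↔
      ∀ ⦃Z : C⦄ (g : Z ⟶ Y) (a : Z ⟶ A), S.Factors (prod.lift a (g ≫ f)) := by
  rw [all, equalizerSubobject_factors_iff, ← (powerEquiv A Y).injective.eq_iff, powerEquiv_comp,
    powerEquiv_comp, Equiv.apply_symm_apply, Equiv.apply_symm_apply, Subobject.pullback_top,
    eq_iff_factors]
  simp only [Limits.pullback_factors_iff, Subobject.top_factors, iff_true]
  constructor
  · intro h Z g a
    simpa using h (prod.lift a g)
  · intro h Z k
    have := h (k ≫ prod.snd) (k ≫ prod.fst)
    convert this using 1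
    apply Limits.prod.hom_ext <;> simp [prod.lift_fst, prod.lift_snd]

/-- The least subobject, as `∀ w : Ω, w`. -/
noncomputable def falsum (X : C) : Subobject X :=
  all ((Subobject.pullback (prod.fst : omega C ⨯ X ⟶ omega C)).obj (truth C))

theorem falsum_factors {X Y : C} (f : Y ⟶ X) :
    (falsum X).Factors f ↔ ∀ ⦃Z : C⦄ (_ : Z ⟶ Y) (w : Z ⟶ omega C), (truth C).Factors w := by
  simp only [falsum, all_factors, Limits.pullback_factors_iff, prod.lift_fst]

/-- Disjunction of subobjects, as `∀ w : Ω, (S → w) ∧ (T → w) → w`. -/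
noncomputable def union {X : C} (S T : Subobject X) : Subobject X :=
  let w := (Subobject.pullback (prod.fst : omega C ⨯ X ⟶ omega C)).obj (truth C)
  let π := Subobject.pullback (prod.snd : omega C ⨯ X ⟶ X)
  all (imp (imp (π.obj S) w ⊓ imp (π.obj T) w) w)

theorem union_factors {X Y : C} (S T : Subobject X) (f : Y ⟶ X) :
    (union S T).Factors f ↔ ∀ ⦃Z : C⦄ (g : Z ⟶ Y) (w : Z ⟶ omega C),
      (∀ ⦃W : C⦄ (h : W ⟶ Z), S.Factors (h ≫ g ≫ f) → (truth C).Factors (h ≫ w)) →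
      (∀ ⦃W : C⦄ (h : W ⟶ Z), T.Factors (h ≫ g ≫ f) → (truth C).Factors (h ≫ w)) →
      (truth C).Factors w := by
  simp only [union, all_factors, imp_factors, Subobject.inf_factors,
    Limits.pullback_factors_iff, Category.assoc, prod.lift_fst, prod.lift_snd]
  constructor
  · intro H Z g w hS hT
    simpa using H g w (𝟙 Z) ⟨fun W h => by simpa using hS h, fun W h => by simpa using hT h⟩
  · rintro H Z g w Z' k ⟨hS, hT⟩
    exact H (k ≫ g) (k ≫ w) (fun W h => by simpa using hS h) (fun W h => by simpa using hT h)

noncomputable instance (X : C) : HeytingAlgebra (Subobject X) where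
  __ := (inferInstance : SemilatticeInf (Subobject X))
  __ := (inferInstance : OrderTop (Subobject X))
  sup := union
  le_sup_left S T := le_iff_factors.2 fun Y f hf => (union_factors S T f).2 fun Z g w hS _ => by
    simpa using hS (𝟙 Z) (Subobject.factors_of_factors_right _
      (Subobject.factors_of_factors_right _ hf))
  le_sup_right S T := le_iff_factors.2 fun Y f hf => (union_factors S T f).2 fun Z g w _ hT => by
    simpa using hT (𝟙 Z) (Subobject.factors_of_factors_right _
      (Subobject.factors_of_factors_right _ hf))
  sup_le S T U hS hT := le_iff_factors.2 fun Y f hf => by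
    -- Restating membership in `U` as a truth value allows the bound variable w of the encoding to
    -- be instantiated with it.
    rw [← truth_factors_char]
    refine (union_factors S T f).1 hf (𝟙 Y) _ (fun W h hW => ?_) fun W h hW => ?_
    all_goals
      rw [Category.id_comp] at hW
      rw [← Category.assoc, truth_factors_char]
    · exact Subobject.factors_of_le _ hS hW
    · exact Subobject.factors_of_le _ hT hW
  himp := imp
  le_himp_iff S T U := by
    simp only [le_iff_factors, imp_factors, Subobject.inf_factors]
    refine ⟨fun H Y f hf => ?_, fun H Y f hf Z g hg =>
      H _ ⟨Subobject.factors_of_factors_right _ hf, hg⟩⟩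
    simpa using H f hf.1 (𝟙 Y) (by simpa using hf.2)
  bot := falsum X
  bot_le S := le_iff_factors.2 fun Y f hf => by
    rw [← truth_factors_char]
    exact (falsum_factors f).1 hf (𝟙 Y) _
  compl S := imp S (falsum X)
  himp_bot _ := rfl

/-- Inverse image along a morphism is a homomorphism of Heyting algebras. -/
noncomputable def pullbackHom {X Y : C} (f : X ⟶ Y) :
    HeytingHom (Subobject Y) (Subobject X) where
  toFun := (Subobject.pullback f).obj
  map_sup' S T := eq_iff_factors.2 fun Z g => by
    change ((Subobject.pullback f).obj (union S T)).Factors g ↔ (union _ _).Factors g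
    -- The forcing clause mentions the element only through its composites, so it is stable under
    -- pullback.
    simp only [Limits.pullback_factors_iff, union_factors, Category.assoc]
  map_inf' := Subobject.inf_pullback f
  map_bot' := eq_iff_factors.2 fun Z g => by
    change ((Subobject.pullback f).obj (falsum Y)).Factors g ↔ (falsum X).Factors g
    simp only [Limits.pullback_factors_iff, falsum_factors]
  map_himp' S T := eq_iff_factors.2 fun Z g => by
    change ((Subobject.pullback f).obj (imp S T)).Factors g ↔ (imp _ _).Factors g
    simp only [Limits.pullback_factors_iff, imp_factors, Category.assoc]

theorem pullbackHom_apply {X Y : C} (f : X ⟶ Y) (S : Subobject Y) :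
    pullbackHom f S = (Subobject.pullback f).obj S :=
  rfl

theorem pullbackHom_char_truth {X : C} (S : Subobject X) :
    pullbackHom (char S) (truth C) = S :=
  eq_iff_factors.2 fun Y f => by
    rw [pullbackHom_apply, Limits.pullback_factors_iff, truth_factors_char]

theorem bangInv_factors {A Y : C} (U : Subobject (⊤_ C)) (f : Y ⟶ A) :
    (bangInv A U).Factors f ↔ U.Factors (terminal.from Y) := by
  rw [bangInv, Limits.pullback_factors_iff, terminal.comp_from]

/-- The point `char U` is a section of Ω ⟶ 1. -/
theorem pullbackHom_char_bangInv (U W : Subobject (⊤_ C)) :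
    pullbackHom (char U) (bangInv (omega C) W) = W :=
  eq_iff_factors.2 fun Y f => by
    rw [pullbackHom_apply, Limits.pullback_factors_iff, bangInv_factors,
      Subsingleton.elim (terminal.from Y) f]

/-- The upper adjoint of inverse image along `A ⟶ 1`. -/
noncomputable def forallBang (A : C) (S : Subobject A) : Subobject (⊤_ C) :=
  all ((Subobject.pullback (prod.fst : A ⨯ ⊤_ C ⟶ A)).obj S)

theorem gc_bangInv_forallBang (A : C) : GaloisConnection (bangInv A) (forallBang A) := by
  intro U S
  simp only [le_iff_factors, bangInv_factors, forallBang, all_factors,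
    Limits.pullback_factors_iff, prod.lift_fst]
  refine ⟨fun H Y f hf Z g a => H a ?_, fun H Y f hf => ?_⟩
  · rw [Subsingleton.elim (terminal.from Z) (g ≫ f)]
    exact Subobject.factors_of_factors_right g hf
  · exact H (terminal.from Y) hf (𝟙 Y) f

/-- The lower adjoint of inverse image along `A ⟶ 1`, as `∀ w : Ω, (∀ x : A, S x → w) → w`. -/
noncomputable def existsBang (A : C) (S : Subobject A) : Subobject (⊤_ C) :=
  let B := omega C ⨯ ⊤_ C
  let w := (Subobject.pullback (prod.fst : B ⟶ omega C)).obj (truth C)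
  all (imp (all (imp ((Subobject.pullback (prod.fst : A ⨯ B ⟶ A)).obj S)
    ((Subobject.pullback (prod.snd : A ⨯ B ⟶ B)).obj w))) w)

theorem gc_existsBang_bangInv (A : C) : GaloisConnection (existsBang A) (bangInv A) := by
  intro S U
  simp only [le_iff_factors, bangInv_factors, existsBang, all_factors, imp_factors,
    Limits.pullback_factors_iff, prod.lift_fst, prod.lift_snd, prod.comp_lift]
  constructor
  · intro H Y f hf
    -- The element `f` itself, restricted to the current stage, witnesses the existential.
    refine H (terminal.from Y) fun Z g w Z' h H' => ?_
    simpa using H' (𝟙 Z') (h ≫ g ≫ f) (𝟙 Z') (by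
      simpa using Subobject.factors_of_factors_right (h ≫ g) hf)
  · intro H Y f hf
    rw [← truth_factors_char]
    -- Instantiate w with the truth value of `U`.
    have := hf (𝟙 Y) (terminal.from Y ≫ char U) (𝟙 Y) fun Z g a Z' h hS => by
      have := (truth_factors_char U (terminal.from Z')).2 (H _ hS)
      simpa using this
    rw [Subsingleton.elim f (terminal.from Y)]
    simpa using this

end ElementaryTopos

/-! ### Uniform interpolants from quantification over truth values -/

namespace ElementaryTopos

open IPC

universe w v u

variable {V : Type w} {C : Type u} [Category.{v} C] [ElementaryTopos C]

open Classical in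
/-- The valuation in `Sub(Ω)` that sends `p` to the generic subobject and every other variable to
the inverse image of the subterminal object that corresponds to it. -/
noncomputable def genericValuation (p : V) {Q : Set V}
    (τ : Subobject (⊤_ C) ≃o FreeHeyting Q) (x : V) : Subobject (omega C) :=
  if x = p then truth C
  else if h : x ∈ Q then
    bangInv (omega C) (τ.symm (FreeHeyting.mk (.var x) (Set.singleton_subset_iff.2 h)))
  else ⊥

variable {p : V} {Q : Set V} (τ : Subobject (⊤_ C) ≃o FreeHeyting Q)

theorem genericValuation_self : genericValuation p τ p = truth C :=
  if_pos rfl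

theorem genericValuation_of_mem (hp : p ∉ Q) {x : V} (hx : x ∈ Q) :
    genericValuation p τ x =
      bangInv (omega C) (τ.symm (FreeHeyting.mk (.var x) (Set.singleton_subset_iff.2 hx))) := by
  rw [genericValuation, if_neg fun h : x = p => hp (h ▸ hx), dif_pos hx]

/-- Without `p`, the generic interpretation is the inverse image of the given one. -/
theorem eval_genericValuation (hp : p ∉ Q) {θ : Formula V} (hθ : θ.vars ⊆ Q) :
    θ.eval (genericValuation p τ) = bangInv (omega C) (τ.symm (FreeHeyting.mk θ hθ)) := by
  classical
  let v : V → FreeHeyting Q := fun x =>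
    if h : x ∈ Q then FreeHeyting.mk (.var x) (Set.singleton_subset_iff.2 h) else ⊥
  have hv : FreeHeyting.mk θ hθ = θ.eval v := by
    have h := FreeHeyting.eval_eq_mk_subst (S := Q) (v := v) (σ := .var) (φ := θ)
      (fun x hx => ⟨Set.singleton_subset_iff.2 (hθ hx), dif_pos (hθ hx)⟩)
      (by rwa [Formula.subst_var])
    simpa only [Formula.subst_var] using h.symm
  change _ = pullbackHom (terminal.from (omega C)) _
  -- An order isomorphism preserves the Heyting operations, so both maps commute with evaluation and
  -- only variables remain to be compared.
  rw [hv, Formula.map_eval τ.symm, Formula.map_eval (pullbackHom _)]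
  refine Formula.eval_congr fun x hx => ?_
  simp only [v, genericValuation_of_mem τ hp (hθ hx), dif_pos (hθ hx)]
  rfl

theorem entails_of_eval_genericValuation_le (hQ : Q.Infinite) (hp : p ∉ Q) {φ ψ : Formula V}
    (hφ : φ.vars ⊆ insert p Q) (hψ : ψ.vars ⊆ insert p Q)
    (h : φ.eval (genericValuation p τ) ≤ ψ.eval (genericValuation p τ)) : Entails φ ψ := by
  classical
  -- Infinitude of `Q` supplies a variable standing in for `p`; its freshness makes the substitution
  -- `σ` reversible by `κ`.
  obtain ⟨q, hqQ, hq⟩ := (hQ.sdiff (φ.vars_finite.union ψ.vars_finite)).nonempty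
  let U : Subobject (⊤_ C) :=
    τ.symm (FreeHeyting.mk (.var q) (Set.singleton_subset_iff.2 hqQ))
  let σ : V → Formula V := fun x => if x = p then .var q else .var x
  let κ : V → Formula V := fun x => if x = q then .var p else .var x
  have hσQ : ∀ x ∈ insert p Q, (σ x).vars ⊆ Q := by
    rintro x (rfl | hx)
    · simpa [σ, Formula.vars] using hqQ
    · simpa [σ, if_neg (fun h => hp (h ▸ hx) : ¬x = p), Formula.vars] using hx
  have hval : ∀ x (hx : x ∈ insert p Q),
      τ (pullbackHom (char U) (genericValuation p τ x)) = FreeHeyting.mk (σ x) (hσQ x hx) := by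
    intro x hx
    by_cases hxp : x = p
    · subst hxp
      simp only [genericValuation_self, pullbackHom_char_truth, σ, if_true, U,
        OrderIso.apply_symm_apply]
    · have hxQ := hx.resolve_left hxp
      simp only [genericValuation_of_mem τ hp hxQ, pullbackHom_char_bangInv, σ, if_neg hxp,
        OrderIso.apply_symm_apply]
  have hmk : ∀ {χ : Formula V}, χ.vars ⊆ insert p Q → ∃ hχ : (χ.subst σ).vars ⊆ Q,
      τ (pullbackHom (char U) (χ.eval (genericValuation p τ))) =
        FreeHeyting.mk (χ.subst σ) hχ := by
    intro χ hχ
    have hχQ := Formula.vars_subst_subset fun x hx => hσQ x (hχ hx)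
    refine ⟨hχQ, ?_⟩
    rw [Formula.map_eval (pullbackHom _), Formula.map_eval τ]
    exact FreeHeyting.eval_eq_mk_subst (fun x hx => ⟨_, hval x (hχ hx)⟩) hχQ
  have hback : ∀ {χ : Formula V}, q ∉ χ.vars → (χ.subst σ).subst κ = χ := by
    intro χ hχ
    rw [Formula.subst_subst]
    refine Formula.subst_eq_self fun x hx => ?_
    by_cases hxp : x = p
    · simp [σ, κ, hxp, Formula.subst]
    · have hxq : x ≠ q := fun h => hχ (h ▸ hx)
      simp [σ, κ, hxp, hxq, Formula.subst]
  obtain ⟨_, h₁⟩ := hmk hφ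
  obtain ⟨_, h₂⟩ := hmk hψ
  have := τ.monotone (OrderHomClass.mono (pullbackHom (char U)) h)
  rw [h₁, h₂, FreeHeyting.mk_le_mk] at this
  have := this.subst κ
  rwa [hback fun h => hq (Or.inl h), hback fun h => hq (Or.inr h)] at this

end ElementaryTopos

section

open ElementaryTopos IPC

theorem mainTheorem3 {V : Type*} (p : V) (Q : Set V) (hQ : Q.Infinite) (hp : p ∉ Q)
    {C : Type*} [Category* C] [ElementaryTopos C]
    (τ : Subobject (⊤_ C) ≃o IPC.FreeHeyting Q) :
    ∃ existsBang forallBang : Subobject (ElementaryTopos.omega C) → Subobject (⊤_ C),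
      GaloisConnection existsBang (ElementaryTopos.bangInv (ElementaryTopos.omega C)) ∧
      GaloisConnection (ElementaryTopos.bangInv (ElementaryTopos.omega C)) forallBang ∧
      ∃ j : IPC.FreeHeyting (insert p Q) → Subobject (ElementaryTopos.omega C),
        IsHeytingEmbedding j ∧
        ∀ (φ : IPC.Formula V) (hφ : φ.vars ⊆ insert p Q),
          (∃ (ε : IPC.Formula V) (hε : ε.vars ⊆ Q),
            IPC.FreeHeyting.mk ε hε = τ (existsBang (j (IPC.FreeHeyting.mk φ hφ))) ∧
            IPC.IsRightUniformInterpolant p φ ε) ∧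
          (∃ (α : IPC.Formula V) (hα : α.vars ⊆ Q),
            IPC.FreeHeyting.mk α hα = τ (forallBang (j (IPC.FreeHeyting.mk φ hφ))) ∧
            IPC.IsLeftUniformInterpolant p φ α) := by
  have hE := gc_existsBang_bangInv (omega C)
  have hA := gc_bangInv_forallBang (omega C)
  refine ⟨existsBang _, forallBang _, hE, hA, FreeHeyting.lift (genericValuation p τ),
    ⟨inferInstance, fun _ _ => Iff.rfl, FreeHeyting.lift (genericValuation p τ), rfl, ?_⟩,
    fun φ hφ => ?_⟩
  · refine FreeHeyting.ind fun φ hφ => FreeHeyting.ind fun ψ hψ h => ?_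
    rw [FreeHeyting.lift_mk, FreeHeyting.lift_mk] at h
    exact (FreeHeyting.mk_eq_mk hφ hψ).2
      ⟨entails_of_eval_genericValuation_le τ hQ hp hφ hψ h.le,
        entails_of_eval_genericValuation_le τ hQ hp hψ hφ h.ge⟩
  have hQp : Q ⊆ insert p Q := Set.subset_insert p Q
  have hsub : ∀ {χ : Formula V}, χ.vars ⊆ φ.vars \ {p} → χ.vars ⊆ Q := fun h x hx =>
    (hφ (h hx).1).resolve_left (h hx).2
  rw [FreeHeyting.lift_mk]
  constructor
  · obtain ⟨ε₀, hε₀, h₀⟩ : ∃ (ε₀ : Formula V) (hε₀ : ε₀.vars ⊆ Q), FreeHeyting.mk ε₀ hε₀ =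
        τ (existsBang _ (φ.eval (genericValuation p τ))) :=
      FreeHeyting.ind (P := fun a => ∃ ε₀ hε₀, FreeHeyting.mk ε₀ hε₀ = a)
        (fun ε₀ hε₀ => ⟨ε₀, hε₀, rfl⟩) _
    -- The adjunction carried across `τ`. Taking θ = `ε₀` gives φ ⊢ `ε₀` because j reflects
    -- entailment; soundness gives minimality over `Q`.
    have key : ∀ {θ : Formula V}, θ.vars ⊆ Q → (Entails ε₀ θ ↔
        φ.eval (genericValuation p τ) ≤ θ.eval (genericValuation p τ)) := fun {θ} hθ => by
      rw [eval_genericValuation τ hp hθ, ← hE.le_iff_le, OrderIso.le_symm_apply, ← h₀,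
        FreeHeyting.mk_le_mk]
    have hφε : Entails φ ε₀ := entails_of_eval_genericValuation_le τ hQ hp hφ (hε₀.trans hQp)
      ((key hε₀).1 (.ax rfl))
    obtain ⟨ε, hε, h₁, h₂, h₃⟩ := exists_uniform_of_extremal hQ hp (R := Entails)
      (fun σ h => h.subst σ) hφ hε₀ hφε
      fun θ hθ h => (key hθ).2 (h.eval_le_eval _)
    -- `ε` and `ε₀` have the same class: `ε₀` is itself a `p`-free consequence of φ, hence entailed
    -- by `ε`.
    exact ⟨ε, hsub hε, ((FreeHeyting.mk_eq_mk _ hε₀).2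
      ⟨h₃ _ (fun h => hp (hε₀ h)) hφε, h₁⟩).trans h₀, hε, h₂, h₃⟩
  · obtain ⟨α₀, hα₀, h₀⟩ : ∃ (α₀ : Formula V) (hα₀ : α₀.vars ⊆ Q), FreeHeyting.mk α₀ hα₀ =
        τ (forallBang _ (φ.eval (genericValuation p τ))) :=
      FreeHeyting.ind (P := fun a => ∃ α₀ hα₀, FreeHeyting.mk α₀ hα₀ = a)
        (fun α₀ hα₀ => ⟨α₀, hα₀, rfl⟩) _
    have key : ∀ {ψ : Formula V}, ψ.vars ⊆ Q → (Entails ψ α₀ ↔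
        ψ.eval (genericValuation p τ) ≤ φ.eval (genericValuation p τ)) := fun {ψ} hψ => by
      rw [eval_genericValuation τ hp hψ, hA.le_iff_le, OrderIso.symm_apply_le, ← h₀,
        FreeHeyting.mk_le_mk]
    have hαφ : Entails α₀ φ := entails_of_eval_genericValuation_le τ hQ hp (hα₀.trans hQp) hφ
      ((key hα₀).1 (.ax rfl))
    obtain ⟨α, hα, h₁, h₂, h₃⟩ := exists_uniform_of_extremal hQ hp
      (R := fun a b => Entails b a) (fun σ h => h.subst σ) hφ hα₀ hαφ
      fun ψ hψ h => (key hψ).2 (h.eval_le_eval _)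
    exact ⟨α, hsub hα, ((FreeHeyting.mk_eq_mk _ hα₀).2
      ⟨h₁, h₃ _ (fun h => hp (hα₀ h)) hαφ⟩).trans h₀, hα, h₂, h₃⟩

end
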